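/- Throughout, $I=[a,b]$ with $a<b$ is a compact interval and $\mathcal M(I)$ is the space of Borel probability measures on $I$ with the Prohorov metric $$\mathcal P(\mu,\nu)=\inf\{\epsilon>0:\ \mu(A)\le\nu(A^\epsilon)+\epsilon \text{ and } \nu(A)\le\mu(A^\epsilon)+\epsilon \text{ for all Borel } A\subset I\},$$ where $A^\epsilon$ is the open $\epsilon$-neighbourhood of $A$. A continuous map $f:I\to I$ induces $\hat f:\mathcal M(I)\to\mathcal M(I)$, $\hat f(\mu)(A)=\mu(f^{-1}(A))$. For a sequence $g_{0,\infty}=(g_n)_{n\ge0}$ of continuous self-maps of a compact metric space $(Y,d)$ put $g_0^0=\mathrm{id}$ and $g_0^n=g_{n-1}\circ\cdots\circ g_0$ for $n\ge1$. The system $(Y,g_{0,\infty})$ is transitive if for all nonempty open $U,V\subset Y$ there is $n\ge1$ with $g_0^n(U)\cap V\ne\emptyset$. Its topological entropy is $$h(g_{0,\infty})=\lim_{\epsilon\to0}\limsup_{n\to\infty}\frac1n\log s_n(\epsilon)\in[0,\infty],$$ where $s_n(\epsilon)$ is the maximal cardinality of a set $E\subset Y$ such that for any two distinct $x,y\in E$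 there is $0\le j\le n-1$ with $d(g_0^j(x),g_0^j(y))>\epsilon$. For a single map $g$, $(Y,g)$ and $h(g)$ refer to the constant sequence $g_n=g$. **Theorem 2.5.** (i) If $f:I\to I$ is continuous and $(I,f)$ is transitive, then $h(\hat f)=\infty$. (ii) There is a sequence $f_{0,\infty}=(f_n)_{n\ge0}$ of continuous self-maps of $I$, converging uniformly on $I$ to the identity, such that $(I,f_{0,\infty})$ is transitive but $h(\hat f_{0,\infty})=0$, where $\hat f_{0,\infty}=(\hat f_n)_{n\ge0}$. -/

import Mathlib

open Set Filter Topology MeasureTheory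

namespace NonAutonomous

noncomputable section

/-- The composition `f₀ⁿ = fₙ₋₁ ∘ ⋯ ∘ f₀` (with `f₀⁰ = id`) of a sequence of self-maps. -/
def iter {X : Type*} (f : ℕ → X → X) : ℕ → X → X
  | 0 => id
  | n + 1 => f n ∘ iter f n

/-- Topological transitivity: for all nonempty open `U`, `V` there is `n ≥ 1` such that
`f₀ⁿ(U) ∩ V ≠ ∅`. -/
def IsTransitive {X : Type*} [TopologicalSpace X] (f : ℕ → X → X) : Prop :=
  ∀ U V : Set X, IsOpen U → IsOpen V → U.Nonempty → V.Nonempty →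
    ∃ n : ℕ, 1 ≤ n ∧ (iter f n '' U ∩ V).Nonempty

/-- `(n, ε)`-separated sets: any two distinct points are more than `ε` apart at one of the times
`0, …, n - 1`. -/
def IsSeparatedSet {X : Type*} [PseudoMetricSpace X] (f : ℕ → X → X) (n : ℕ) (ε : ℝ)
    (E : Set X) : Prop :=
  ∀ x ∈ E, ∀ y ∈ E, x ≠ y → ∃ j < n, ε < dist (iter f j x) (iter f j y)

/-- The maximal cardinality of an `(n, ε)`-separated set. -/
def maxSeparated {X : Type*} [PseudoMetricSpace X] (f : ℕ → X → X) (n : ℕ) (ε : ℝ) : ℕ∞ :=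
  ⨆ (E : Set X) (_ : IsSeparatedSet f n ε E), E.encard

/-- The exponential growth rate `limsup (1/n) log sₙ(ε)`, as an extended real number. -/
def entropyAt {X : Type*} [PseudoMetricSpace X] (f : ℕ → X → X) (ε : ℝ) : EReal :=
  limsup (fun n : ℕ => ENNReal.log (maxSeparated f n ε : ENNReal) / (n : EReal)) atTop

/-- The topological entropy of a sequence of self-maps. As `entropyAt f ε` grows when `ε`
decreases, its limit as `ε → 0` is its supremum over `ε > 0`; see `tendsto_entropyAt`. -/
def entropy {X : Type*} [PseudoMetricSpace X] (f : ℕ → X → X) : EReal :=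
  ⨆ (ε : ℝ) (_ : 0 < ε), entropyAt f ε

theorem entropyAt_antitone {X : Type*} [PseudoMetricSpace X] (f : ℕ → X → X) :
    Antitone (entropyAt f) := by
  intro ε δ h
  refine limsup_le_limsup (Eventually.of_forall fun n => ?_)
  refine EReal.div_le_div_right_of_nonneg (by positivity) (ENNReal.log_monotone ?_)
  refine ENat.toENNReal_mono (iSup_mono fun E => iSup_mono' fun hE => ⟨?_, le_rfl⟩)
  intro x hx y hy hxy
  obtain ⟨j, hj, hd⟩ := hE x hx y hy hxy
  exact ⟨j, hj, h.trans_lt hd⟩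

theorem tendsto_entropyAt {X : Type*} [PseudoMetricSpace X] (f : ℕ → X → X) :
    Tendsto (entropyAt f) (𝓝[>] 0) (𝓝 (entropy f)) := by
  have h := (entropyAt_antitone f).tendsto_nhdsGT (0 : ℝ)
  rwa [sSup_image] at h

/-- The space `M(X)` of Borel probability measures on `X`; Mathlib's type `LevyProkhorov _`
carries the Prohorov metric. -/
abbrev ProbSpace (X : Type*) [MeasurableSpace X] : Type _ :=
  LevyProkhorov (ProbabilityMeasure X)

/-- The map induced on `M(X)` by a continuous self-map: `μ ↦ μ(f⁻¹(·))`. -/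
def induced {X : Type*} [TopologicalSpace X] [MeasurableSpace X] [BorelSpace X] (f : C(X, X)) :
    ProbSpace X → ProbSpace X :=
  fun μ => LevyProkhorov.ofMeasure (μ.toMeasure.map f.continuous.measurable.aemeasurable)

end

end NonAutonomous

/-!
Both parts come down to elementary one-dimensional dynamics.

A transitive interval map `f` has a fixed point `p` in the interior. Either another interior point
`q` is mapped to `p`, or `f` swaps the two sides of `p`. In the first case transitivity gives an
iterate `g` with `g d = q` for some `d` between `p` and `q`, so `p` is homoclinic to itself and
`g²` maps each of two disjoint intervals over both. In the second case `f²` is transitive on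
`[p, b]`, its interior fixed point falls under the first case because `p` is fixed as well, and
the horseshoe of `f²` is one of `f` (`TransitiveOn.hasHorseshoe`). A horseshoe of `f^N` realizes
all itineraries, so the averages of `m` Dirac masses realize every sequence of masses `k / m`,
`0 ≤ k ≤ m`, on one of the two intervals. Different masses keep the averages a fixed Prohorov
distance apart, whence the induced map has entropy at least `log (m + 1) / N` for every `m`
(`entropy_induced_eq_top`).

For the second part, take the flow on `[a, b]` that fixes the end points and multiplies
`(x - a) / (b - x)` by `exp s`. It moves every interior point to every other one, so following it
along times that are dense in the line and have increments tending to `0` is a transitive sequence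
of maps converging to the identity (`isTransitive_oscMap`). Inserting identity maps destroys
neither property. Since the space of measures is compact, the separated sets of the induced system
for a given number of steps and a given scale are bounded in size, and long runs of identity maps
make the growth rate `0` (`exists_slowdown`).
-/

namespace NonAutonomous

/-! ### Separated sets and entropy -/

section Separated

variable {X : Type*} [PseudoMetricSpace X]

theorem one_le_maxSeparated [Nonempty X] (f : ℕ → X → X) (n : ℕ) (ε : ℝ) :
    1 ≤ maxSeparated f n ε := by
  obtain ⟨x⟩ := ‹Nonempty X›
  refine le_iSup₂_of_le {x} ?_ (by simp)
  rintro y rfl z rfl h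
  exact absurd rfl h

theorem entropy_nonneg [Nonempty X] (f : ℕ → X → X) : 0 ≤ entropy f := by
  refine le_iSup₂_of_le 1 one_pos ?_
  refine le_limsup_of_frequently_le (Frequently.of_forall fun n => ?_)
  refine EReal.div_nonneg ?_ (by positivity)
  rw [← ENNReal.log_one]
  exact ENNReal.log_monotone (by exact_mod_cast one_le_maxSeparated f n 1)

theorem maxSeparated_anti (f : ℕ → X → X) (n : ℕ) : Antitone (maxSeparated f n) := by
  intro ε δ h
  refine iSup_mono fun E => iSup_mono' fun hE => ⟨?_, le_rfl⟩
  intro x hx y hy hxy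
  obtain ⟨j, hj, hd⟩ := hE x hx y hy hxy
  exact ⟨j, hj, h.trans_lt hd⟩

/-- If every map of the first system visited before time `n` is visited by the second one before
time `k`, then the first system has no larger separated sets. -/
theorem maxSeparated_le_of_iter (f g : ℕ → X → X) (n k : ℕ) (ε : ℝ)
    (h : ∀ j < n, ∃ i < k, iter f j = iter g i) : maxSeparated f n ε ≤ maxSeparated g k ε := by
  refine iSup_mono fun E => iSup_mono' fun hE => ⟨?_, le_rfl⟩
  intro x hx y hy hxy
  obtain ⟨j, hj, hd⟩ := hE x hx y hy hxy
  obtain ⟨i, hi, hji⟩ := h j hj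
  exact ⟨i, hi, by rwa [← hji]⟩

theorem continuous_iter (f : ℕ → X → X) (hf : ∀ n, Continuous (f n)) (n : ℕ) :
    Continuous (iter f n) := by
  induction n with
  | zero => exact continuous_id
  | succ n ih => exact (hf n).comp ih

/-- On a compact space the separated sets for a fixed number of steps have bounded
cardinality. -/
theorem maxSeparated_lt_top [CompactSpace X] (f : ℕ → X → X) (hf : ∀ n, Continuous (f n)) (n : ℕ)
    {ε : ℝ} (hε : 0 < ε) : maxSeparated f n ε < ⊤ := by
  -- A finite cover by sets whose first `n` images are small meets a separated set injectively.
  set Φ : X → Fin n → X := fun x j => iter f j x with hΦ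
  have hΦc : Continuous Φ := continuous_pi fun j => continuous_iter f hf j
  obtain ⟨t, -, ht⟩ := (isCompact_univ (X := X)).elim_nhds_subcover
    (fun x => Φ ⁻¹' Metric.ball (Φ x) (ε / 2))
    (fun x _ => hΦc.continuousAt.preimage_mem_nhds (Metric.ball_mem_nhds _ (half_pos hε)))
  have hcov : ∀ x, ∃ y ∈ t, Φ x ∈ Metric.ball (Φ y) (ε / 2) := fun x => by
    simpa using ht (mem_univ x)
  choose c hc hcb using hcov
  refine lt_of_le_of_lt (b := (t : Set X).encard) (iSup₂_le fun E hE => ?_)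
    (encard_lt_top_iff.2 t.finite_toSet)
  refine encard_le_encard_of_injOn (f := c) (fun x _ => hc x) fun x hx y hy hxy => ?_
  by_contra hne
  obtain ⟨j, hj, hd⟩ := hE x hx y hy hne
  have h₁ := (dist_le_pi_dist (Φ x) (Φ (c x)) ⟨j, hj⟩).trans_lt (hcb x)
  have h₂ := (dist_le_pi_dist (Φ y) (Φ (c x)) ⟨j, hj⟩).trans_lt (by rw [hxy]; exact hcb y)
  have := dist_triangle_right (iter f j x) (iter f j y) (iter f j (c x))
  simp only [hΦ] at h₁ h₂
  linarith

theorem log_natCast {m : ℕ} (hm : 1 ≤ m) : ENNReal.log (m : ENNReal) = (Real.log m : ℝ) := by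
  rw [← ENNReal.ofReal_natCast, ENNReal.log_ofReal_of_pos (by exact_mod_cast hm)]

/-- Exponentially many separated orbit segments along the multiples of `N` bound the entropy from
below. -/
theorem log_div_le_entropy (f : ℕ → X → X) {N m : ℕ} (hN : 1 ≤ N) (hm : 1 ≤ m) {ε : ℝ} (hε : 0 < ε)
    (h : ∀ n, (m ^ n : ℕ) ≤ maxSeparated f (N * n) ε) :
    ((Real.log m / N : ℝ) : EReal) ≤ entropy f := by
  refine le_iSup₂_of_le ε hε (le_limsup_of_frequently_le ?_)
  rw [frequently_atTop]
  intro k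
  refine ⟨N * (k + 1), by nlinarith, ?_⟩
  have h0 : (0 : ℝ) < ((N * (k + 1) : ℕ) : ℝ) := by positivity
  rw [EReal.le_div_iff_mul_le (by exact_mod_cast h0) (EReal.natCast_ne_top _)]
  have hle : ((m ^ (k + 1) : ℕ) : ENNReal) ≤ (maxSeparated f (N * (k + 1)) ε : ENNReal) := by
    have := ENat.toENNReal_mono (h (k + 1))
    simpa using this
  refine le_trans (le_of_eq ?_) (ENNReal.log_monotone hle)
  rw [log_natCast (Nat.one_le_pow _ _ hm), ← EReal.coe_coe_eq_natCast, ← EReal.coe_mul]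
  congr 1
  have : (N : ℝ) ≠ 0 := by positivity
  push_cast
  rw [Real.log_pow]
  push_cast
  field_simp

end Separated

/-! ### The induced maps on probability measures -/

section Induced

variable {X : Type*} [PseudoMetricSpace X] [MeasurableSpace X] [BorelSpace X]

theorem induced_id : induced (ContinuousMap.id X) = id := by
  funext μ
  refine LevyProkhorov.toMeasure_injective (ProbabilityMeasure.toMeasure_injective ?_)
  exact Measure.map_id

theorem continuous_induced [SecondCountableTopology X] (f : C(X, X)) :
    Continuous (induced f) :=
  LevyProkhorov.continuous_ofMeasure_probabilityMeasure.comp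
    ((ProbabilityMeasure.continuous_map f.continuous).comp
      LevyProkhorov.continuous_toMeasure_probabilityMeasure)

end Induced

instance compactSpace_probSpace {X : Type*} [MetricSpace X] [CompactSpace X] [MeasurableSpace X]
    [BorelSpace X] : CompactSpace (ProbSpace X) :=
  (LevyProkhorov.probabilityMeasureHomeomorph (Ω := X)).compactSpace

/-! ### Horseshoes of transitive interval maps -/

/-- Transitivity of a map `F : ℝ → ℝ` restricted to the interval `[a, b]`, tested on open
subintervals. -/
def TransitiveOn (F : ℝ → ℝ) (a b : ℝ) : Prop :=
  ∀ x y u v, a ≤ x → x < y → y ≤ b → a ≤ u → u < v → v ≤ b →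
    ∃ n, 1 ≤ n ∧ ∃ t ∈ Ioo x y, F^[n] t ∈ Ioo u v

/-- A strict horseshoe of some iterate of `F` in `[a, b]`: two disjoint compact intervals
`[c, d]` and `[e, f]`, each of which is mapped by `F^[N]` over the convex hull of both. -/
def HasHorseshoe (F : ℝ → ℝ) (a b : ℝ) : Prop :=
  ∃ N, 1 ≤ N ∧ ∃ c d e f, a ≤ c ∧ c ≤ d ∧ d < e ∧ e ≤ f ∧ f ≤ b ∧
    Icc c f ⊆ F^[N] '' Icc c d ∧ Icc c f ⊆ F^[N] '' Icc e f

theorem iterate_neg_conj (F : ℝ → ℝ) (n : ℕ) (x : ℝ) :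
    (fun y => -F (-y))^[n] x = -F^[n] (-x) := by
  induction n generalizing x with
  | zero => simp
  | succ n ih => simp [ih]

theorem TransitiveOn.neg_conj {F : ℝ → ℝ} {a b : ℝ} (h : TransitiveOn F a b) :
    TransitiveOn (fun y => -F (-y)) (-b) (-a) := by
  intro x y u v hx hxy hy hu huv hv
  obtain ⟨n, hn, t, ht, htn⟩ := h (-y) (-x) (-v) (-u) (by linarith) (by linarith) (by linarith)
    (by linarith) (by linarith) (by linarith)
  refine ⟨n, hn, -t, ⟨by linarith [ht.2], by linarith [ht.1]⟩, ?_⟩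
  rw [iterate_neg_conj, neg_neg]
  exact ⟨by linarith [htn.2], by linarith [htn.1]⟩

theorem HasHorseshoe.of_neg_conj {F : ℝ → ℝ} {a b : ℝ}
    (h : HasHorseshoe (fun y => -F (-y)) (-b) (-a)) : HasHorseshoe F a b := by
  obtain ⟨N, hN, c, d, e, f, hc, hcd, hde, hef, hf, h₁, h₂⟩ := h
  have key : ∀ s t, Icc c f ⊆ (fun y => -F (-y))^[N] '' Icc s t →
      Icc (-f) (-c) ⊆ F^[N] '' Icc (-t) (-s) := by
    intro s t hst z hz
    obtain ⟨w, hw, hwz⟩ := hst (show -z ∈ Icc c f from ⟨by linarith [hz.2], by linarith [hz.1]⟩)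
    rw [iterate_neg_conj] at hwz
    exact ⟨-w, ⟨by linarith [hw.2], by linarith [hw.1]⟩, by linarith⟩
  exact ⟨N, hN, -f, -e, -d, -c, by linarith, by linarith, by linarith, by linarith, by linarith,
    key _ _ h₂, key _ _ h₁⟩

/-- A transitive map leaves no proper nondegenerate subinterval invariant. -/
theorem TransitiveOn.eq_of_mapsTo {F : ℝ → ℝ} {a b c d : ℝ} (h : TransitiveOn F a b)
    (hac : a ≤ c) (hcd : c < d) (hdb : d ≤ b) (hm : MapsTo F (Icc c d) (Icc c d)) :
    c = a ∧ d = b := by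
  constructor
  · by_contra hne
    obtain ⟨n, -, t, ht, htn⟩ := h c d a c hac hcd hdb le_rfl (lt_of_le_of_ne hac (Ne.symm hne))
      (hcd.le.trans hdb)
    exact absurd (hm.iterate n (Ioo_subset_Icc_self ht)).1 (not_le.2 htn.2)
  · by_contra hne
    obtain ⟨n, -, t, ht, htn⟩ := h c d d b hac hcd hdb (hac.trans hcd.le) (lt_of_le_of_ne hdb hne)
      le_rfl
    exact absurd (hm.iterate n (Ioo_subset_Icc_self ht)).2 (not_le.2 htn.1)

theorem nonneg_or_nonpos_of_ne_zero {G : ℝ → ℝ} (hG : Continuous G) {c d : ℝ} (hcd : c < d)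
    (h : ∀ x ∈ Ioo c d, G x ≠ 0) :
    (∀ x ∈ Icc c d, 0 ≤ G x) ∨ (∀ x ∈ Icc c d, G x ≤ 0) := by
  have hcl : closure (Ioo c d) = Icc c d := closure_Ioo hcd.ne
  have key : (∀ x ∈ Ioo c d, 0 ≤ G x) ∨ (∀ x ∈ Ioo c d, G x ≤ 0) := by
    by_contra hcon
    push Not at hcon
    obtain ⟨⟨x, hx, hx0⟩, y, hy, hy0⟩ := hcon
    obtain ⟨z, hz, hz0⟩ := isPreconnected_Ioo.intermediate_value hx hy hG.continuousOn
      ⟨hx0.le, hy0.le⟩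
    exact h z hz hz0
  rw [← hcl]
  refine key.imp (fun h x hx => ?_) (fun h x hx => ?_)
  · exact closure_minimal h (isClosed_Ici.preimage hG) hx
  · exact closure_minimal h (isClosed_Iic.preimage hG) hx

theorem TransitiveOn.exists_fixed {F : ℝ → ℝ} {a b : ℝ} (hab : a < b) (hF : Continuous F)
    (hm : MapsTo F (Icc a b) (Icc a b)) (h : TransitiveOn F a b) : ∃ p ∈ Ioo a b, F p = p := by
  by_contra hcon
  push Not at hcon
  have hsign := nonneg_or_nonpos_of_ne_zero (G := fun x => F x - x) (by fun_prop) hab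
    (fun x hx => sub_ne_zero.2 (hcon x hx))
  -- If `F - id` keeps its sign, then one of the two halves of the interval is invariant.
  rcases hsign with hs | hs
  · have := h.eq_of_mapsTo (c := (a + b) / 2) (d := b) (by linarith) (by linarith) le_rfl
      fun x hx => by
        have hx' : x ∈ Icc a b := ⟨by linarith [hx.1], hx.2⟩
        exact ⟨by linarith [hs x hx', hx.1], (hm hx').2⟩
    linarith [this.1]
  · have := h.eq_of_mapsTo (c := a) (d := (a + b) / 2) le_rfl (by linarith) (by linarith)
      fun x hx => by
        have hx' : x ∈ Icc a b := ⟨hx.1, by linarith [hx.2]⟩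
        exact ⟨(hm hx').1, by linarith [hs x hx', hx.2]⟩
    linarith [this.2]

/-- A fixed point of a transitive map either has a second preimage inside the interval, or the
map swaps the two sides of the fixed point. -/
theorem TransitiveOn.exists_preimage_or_swap {F : ℝ → ℝ} {a b p : ℝ} (hF : Continuous F)
    (hm : MapsTo F (Icc a b) (Icc a b)) (h : TransitiveOn F a b) (hp : p ∈ Ioo a b) :
    (∃ q ∈ Ioo a b, q ≠ p ∧ F q = p) ∨
      (MapsTo F (Icc a p) (Icc p b) ∧ MapsTo F (Icc p b) (Icc a p)) := by
  by_cases hq : ∃ q ∈ Ioo a b, q ≠ p ∧ F q = p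
  · exact Or.inl hq
  push Not at hq
  obtain ⟨hap, hpb⟩ := hp
  have hG : Continuous fun x => F x - p := by fun_prop
  have hmL : ∀ x ∈ Icc a p, F x ∈ Icc a b := fun x hx => hm ⟨hx.1, hx.2.trans hpb.le⟩
  have hmR : ∀ x ∈ Icc p b, F x ∈ Icc a b := fun x hx => hm ⟨hap.le.trans hx.1, hx.2⟩
  refine Or.inr ⟨?_, ?_⟩
  · rcases nonneg_or_nonpos_of_ne_zero hG hap (fun x hx =>
      sub_ne_zero.2 (hq x ⟨hx.1, hx.2.trans hpb⟩ hx.2.ne)) with hs | hs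
    · exact fun x hx => ⟨by linarith [hs x hx], (hmL x hx).2⟩
    · have := h.eq_of_mapsTo le_rfl hap hpb.le
        (fun x hx => ⟨(hmL x hx).1, by linarith [hs x hx]⟩)
      linarith [this.2]
  · rcases nonneg_or_nonpos_of_ne_zero hG hpb (fun x hx =>
      sub_ne_zero.2 (hq x ⟨hap.trans hx.1, hx.2⟩ hx.1.ne')) with hs | hs
    · have := h.eq_of_mapsTo hap.le hpb le_rfl
        (fun x hx => ⟨by linarith [hs x hx], (hmR x hx).2⟩)
      linarith [this.1]
    · exact fun x hx => ⟨(hmR x hx).1, by linarith [hs x hx]⟩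

/-- A preimage `q > p` of a fixed point `p` gives a horseshoe: by transitivity some iterate maps
a point between `p` and `q` onto `q`, so that `p` has a homoclinic orbit under this iterate. -/
theorem TransitiveOn.hasHorseshoe_of_lt {F : ℝ → ℝ} {a b p q : ℝ} (hF : Continuous F)
    (h : TransitiveOn F a b) (hap : a ≤ p) (hpq : p < q) (hqb : q < b) (hp : F p = p)
    (hq : F q = p) : HasHorseshoe F a b := by
  have hpn : ∀ n, F^[n] p = p := fun n => Function.iterate_fixed hp n
  obtain ⟨n, hn, t, ht, htn⟩ := h p q q b hap hpq hqb.le (hap.trans hpq.le) hqb le_rfl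
  have hg : Continuous F^[n] := hF.iterate n
  set g := F^[n] with hgdef
  have hgp : g p = p := hpn n
  have hgq : g q = p := by
    obtain ⟨k, rfl⟩ := Nat.exists_eq_add_of_le' hn
    rw [hgdef, Function.iterate_succ_apply, hq, hpn]
  -- The points `p < e < d < q` with `g d = q` and `g e = d` are homoclinic to `p`.
  obtain ⟨d, hd, hgd⟩ := intermediate_value_Icc ht.1.le hg.continuousOn
    (show q ∈ Icc (g p) (g t) from ⟨by linarith, htn.1.le⟩)
  have hdq : d < q := hd.2.trans_lt ht.2
  obtain ⟨e, he, hge⟩ := intermediate_value_Icc hd.1 hg.continuousOn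
    (show d ∈ Icc (g p) (g d) from ⟨by linarith [hd.1], by linarith⟩)
  have hed : e < d := lt_of_le_of_ne he.2 (by rintro rfl; linarith)
  have c₁ : Icc p d ⊆ g '' Icc p e := by
    have := intermediate_value_Icc he.1 hg.continuousOn
    rwa [hgp, hge] at this
  have c₂ : Icc p q ⊆ g '' Icc p d := by
    have := intermediate_value_Icc hd.1 hg.continuousOn
    rwa [hgp, hgd] at this
  have c₃ : Icc p q ⊆ g '' Icc d q := by
    have := intermediate_value_Icc' hdq.le hg.continuousOn
    rwa [hgq, hgd] at this
  have h2 : F^[n * 2] = g ∘ g := by rw [Function.iterate_mul]; rfl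
  refine ⟨n * 2, by omega, p, e, d, q, hap, he.1, hed, hdq.le, hqb.le, ?_, ?_⟩
  · rw [h2, image_comp]
    exact c₂.trans (image_mono c₁)
  · rw [h2, image_comp]
    exact c₃.trans (image_mono ((Icc_subset_Icc_left hd.1).trans c₃))

theorem TransitiveOn.hasHorseshoe_of_ne {F : ℝ → ℝ} {a b p q : ℝ} (hF : Continuous F)
    (h : TransitiveOn F a b) (hpI : p ∈ Icc a b) (hqI : q ∈ Ioo a b) (hqp : q ≠ p) (hp : F p = p)
    (hq : F q = p) : HasHorseshoe F a b := by
  rcases lt_or_gt_of_ne hqp with hlt | hlt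
  · refine HasHorseshoe.of_neg_conj (h.neg_conj.hasHorseshoe_of_lt (p := -p) (q := -q)
      (by fun_prop) ?_ ?_ ?_ ?_ ?_)
    · linarith [hpI.2]
    · linarith
    · linarith [hqI.1]
    · simp [hp]
    · simp [hq]
  · exact h.hasHorseshoe_of_lt hF hpI.1 hlt hqI.2 hp hq

/-- If `F` swaps the two sides of `p`, then its square is transitive on the right side. -/
theorem TransitiveOn.sq_of_swap {F : ℝ → ℝ} {a b p : ℝ} (h : TransitiveOn F a b)
    (hp : p ∈ Ioo a b) (h₁ : MapsTo F (Icc a p) (Icc p b)) (h₂ : MapsTo F (Icc p b) (Icc a p)) :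
    TransitiveOn F^[2] p b := by
  intro x y u v hx hxy hy hu huv hv
  obtain ⟨n, hn, t, ht, htn⟩ := h x y u v (hp.1.le.trans hx) hxy hy (hp.1.le.trans hu) huv hv
  have htI : t ∈ Icc p b := ⟨hx.trans ht.1.le, ht.2.le.trans hy⟩
  have hsq : MapsTo F^[2] (Icc p b) (Icc p b) := h₁.comp h₂
  rcases Nat.even_or_odd' n with ⟨k, rfl | rfl⟩
  · exact ⟨k, by omega, t, ht, by rwa [← Function.iterate_mul]⟩
  · have := h₂ (hsq.iterate k htI)
    rw [← Function.iterate_mul, ← Function.iterate_succ_apply' F (2 * k) t] at this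
    exact absurd (this.2.trans hu) (not_le.2 htn.1)

theorem TransitiveOn.hasHorseshoe {F : ℝ → ℝ} {a b : ℝ} (hab : a < b) (hF : Continuous F)
    (hm : MapsTo F (Icc a b) (Icc a b)) (h : TransitiveOn F a b) : HasHorseshoe F a b := by
  obtain ⟨p, hpI, hp⟩ := h.exists_fixed hab hF hm
  rcases h.exists_preimage_or_swap hF hm hpI with ⟨q, hqI, hqp, hq⟩ | ⟨h₁, h₂⟩
  · exact h.hasHorseshoe_of_ne hF (Ioo_subset_Icc_self hpI) hqI hqp hp hq
  have hsq := h.sq_of_swap hpI h₁ h₂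
  have hF2 : Continuous F^[2] := hF.iterate 2
  have hm2 : MapsTo F^[2] (Icc p b) (Icc p b) := h₁.comp h₂
  obtain ⟨r, hrI, hr⟩ := hsq.exists_fixed hpI.2 hF2 hm2
  rcases hsq.exists_preimage_or_swap hF2 hm2 hrI with ⟨q, hqI, hqp, hq⟩ | ⟨h₃, -⟩
  · obtain ⟨N, hN, c, d, e, f, hc, H⟩ :=
      hsq.hasHorseshoe_of_ne hF2 (Ioo_subset_Icc_self hrI) hqI hqp hr hq
    rw [← Function.iterate_mul] at H
    exact ⟨2 * N, by omega, c, d, e, f, hpI.1.le.trans hc, H⟩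
  · -- `F^[2]` fixes the end point `p` of `[p, b]`, so it cannot swap the two sides of `r`.
    have := (h₃ ⟨le_rfl, hrI.1.le⟩).1
    rw [Function.iterate_fixed hp] at this
    exact absurd this (not_le.2 hrI.1)

theorem iter_const {X : Type*} (f : X → X) (n : ℕ) : iter (fun _ => f) n = f^[n] := by
  induction n with
  | zero => rfl
  | succ n ih => rw [iter, ih, Function.iterate_succ']

/-- Every transitive self-map of a nondegenerate compact interval has an iterate that maps each
of two sets at positive distance over both. -/
theorem IsTransitive.exists_horseshoe {a b : ℝ} (hab : a < b) (f : C(Icc a b, Icc a b))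
    (hf : IsTransitive (fun _ : ℕ => ⇑f)) :
    ∃ N, 1 ≤ N ∧ ∃ J : Bool → Set (Icc a b), (∀ i, IsClosed (J i)) ∧ (∀ i, (J i).Nonempty) ∧
      (∃ δ > 0, ∀ x ∈ J true, ∀ y ∈ J false, δ ≤ dist x y) ∧
      ∀ i j, J j ⊆ f^[N] '' J i := by
  set F : ℝ → ℝ := fun x => f (projIcc a b hab.le x) with hFdef
  have hF : Continuous F := by
    have := continuous_projIcc (h := hab.le)
    fun_prop
  have hFf : ∀ x : Icc a b, F x = f x := fun x => by simp [hFdef]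
  have hFn : ∀ n, ∀ x : Icc a b, F^[n] x = f^[n] x := fun n x =>
    ((show Function.Semiconj Subtype.val f F from fun x => (hFf x).symm).iterate_right n x).symm
  have hm : MapsTo F (Icc a b) (Icc a b) := fun x _ => (f _).2
  have hT : TransitiveOn F a b := by
    intro x y u v hx hxy hy hu huv hv
    have hne : ∀ s t, a ≤ s → s < t → t ≤ b → ((↑) ⁻¹' Ioo s t : Set (Icc a b)).Nonempty :=
      fun s t hs hst ht =>
        ⟨⟨(s + t) / 2, by constructor <;> linarith⟩, by constructor <;> dsimp only <;> linarith⟩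
    obtain ⟨n, hn, _, ⟨t, ht, rfl⟩, hz⟩ := hf _ _ (isOpen_Ioo.preimage continuous_subtype_val)
      (isOpen_Ioo.preimage continuous_subtype_val) (hne x y hx hxy hy) (hne u v hu huv hv)
    rw [iter_const] at hz
    exact ⟨n, hn, t, ht, by rw [hFn]; exact hz⟩
  obtain ⟨N, hN, c, d, e, g, hc, hcd, hde, heg, hg, h₁, h₂⟩ := hT.hasHorseshoe hab hF hm
  have hcov : ∀ s t, a ≤ s → t ≤ b → Icc c g ⊆ F^[N] '' Icc s t → ∀ K ⊆ Icc c g,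
      ((↑) ⁻¹' K : Set (Icc a b)) ⊆ f^[N] '' ((↑) ⁻¹' Icc s t) := by
    intro s t hs ht hst K hK z hz
    obtain ⟨w, hw, hwz⟩ := hst (hK hz)
    refine ⟨⟨w, hs.trans hw.1, hw.2.trans ht⟩, hw, Subtype.ext ?_⟩
    rw [← hFn]
    exact hwz
  have hK₁ : Icc c d ⊆ Icc c g := Icc_subset_Icc_right (hde.le.trans heg)
  have hK₂ : Icc e g ⊆ Icc c g := Icc_subset_Icc_left (hcd.trans hde.le)
  refine ⟨N, hN, fun i => (↑) ⁻¹' (if i then Icc c d else Icc e g), ?_, ?_,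
    ⟨e - d, sub_pos.2 hde, ?_⟩, ?_⟩
  · intro i
    refine IsClosed.preimage continuous_subtype_val ?_
    split_ifs <;> exact isClosed_Icc
  · rintro (_ | _)
    · exact ⟨⟨e, by linarith, by linarith⟩, by simpa using heg⟩
    · exact ⟨⟨c, by linarith, by linarith⟩, by simpa using hcd⟩
  · intro x hx y hy
    simp only [if_true, mem_preimage, mem_Icc, Bool.false_eq_true, if_false] at hx hy
    rw [Subtype.dist_eq, dist_comm, Real.dist_eq]
    exact le_trans (by linarith [hx.2, hy.1]) (le_abs_self _)
  · rintro (_ | _) (_ | _) <;> simp only [if_true, Bool.false_eq_true, if_false]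
    · exact hcov e g (by linarith) hg h₂ _ hK₂
    · exact hcov e g (by linarith) hg h₂ _ hK₁
    · exact hcov c d hc (by linarith) h₁ _ hK₂
    · exact hcov c d hc (by linarith) h₁ _ hK₁

/-! ### Empirical measures and infinite entropy -/

section Empirical

variable {X : Type*} [MeasurableSpace X]

/-- The empirical measure `(1/m) ∑ δ_{x i}` of a nonempty finite family of points. -/
noncomputable def empirical {m : ℕ} [NeZero m] (x : Fin m → X) : ProbSpace X :=
  LevyProkhorov.ofMeasure ⟨(m : ENNReal)⁻¹ • ∑ i, Measure.dirac (x i), ⟨by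
    simp [ENNReal.inv_mul_cancel, NeZero.ne m]⟩⟩

open Classical in
theorem empirical_apply {m : ℕ} [NeZero m] (x : Fin m → X) {B : Set X} (hB : MeasurableSet B) :
    ((empirical x).toMeasure : Measure X) B =
      ENNReal.ofReal ((Finset.univ.filter fun i => x i ∈ B).card / m) := by
  have hm : (0 : ℝ) < m := by exact_mod_cast Nat.pos_of_ne_zero (NeZero.ne m)
  have : ((empirical x).toMeasure : Measure X) = (m : ENNReal)⁻¹ • ∑ i, Measure.dirac (x i) := rfl
  rw [this, ENNReal.ofReal_div_of_pos hm, ENNReal.ofReal_natCast, ENNReal.ofReal_natCast,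
    ENNReal.div_eq_inv_mul]
  simp [Measure.finsetSum_apply, Measure.dirac_apply' _ hB, indicator_apply, Finset.sum_boole]

variable [PseudoMetricSpace X] [BorelSpace X]

theorem induced_empirical {m : ℕ} [NeZero m] (f : C(X, X)) (x : Fin m → X) :
    induced f (empirical x) = empirical (f ∘ x) := by
  refine LevyProkhorov.toMeasure_injective (ProbabilityMeasure.toMeasure_injective ?_)
  have hf := f.continuous.measurable
  change Measure.map f ((m : ENNReal)⁻¹ • ∑ i, Measure.dirac (x i)) =
    (m : ENNReal)⁻¹ • ∑ i, Measure.dirac (f (x i))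
  rw [Measure.map_smul, Measure.map_finset_sum hf.aemeasurable]
  simp_rw [Measure.map_dirac' hf]

theorem iter_induced_empirical {m : ℕ} [NeZero m] (f : C(X, X)) (x : Fin m → X) (n : ℕ) :
    iter (fun _ => induced f) n (empirical x) = empirical (f^[n] ∘ x) := by
  induction n with
  | zero => rfl
  | succ n ih =>
    rw [iter, Function.comp_apply, ih, induced_empirical, Function.iterate_succ']
    rfl

open Classical in
/-- Empirical measures on the union of two sets at distance at least `δ` are far apart as soon as
they give different masses to the first set. -/
theorem le_dist_empirical {m : ℕ} [NeZero m] {K L : Set X} (hK : IsClosed K) {δ : ℝ} (hδ : 0 < δ)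
    (hKL : ∀ x ∈ K, ∀ y ∈ L, δ ≤ dist x y) (x y : Fin m → X) (hy : ∀ i, y i ∈ K ∨ y i ∈ L)
    (hlt : (Finset.univ.filter fun i => y i ∈ K).card <
      (Finset.univ.filter fun i => x i ∈ K).card) :
    min δ (1 / (m + 1)) ≤ dist (empirical x) (empirical y) := by
  by_contra! hcon
  set c := min δ (1 / ((m : ℝ) + 1)) with hc
  have hm : (0 : ℝ) < m := by exact_mod_cast Nat.pos_of_ne_zero (NeZero.ne m)
  have hc0 : 0 < c := lt_min hδ (by positivity)
  rw [LevyProkhorov.dist_probabilityMeasure_def, levyProkhorovDist,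
    ← ENNReal.lt_ofReal_iff_toReal_lt (levyProkhorovEDist_ne_top _ _)] at hcon
  have h := left_measure_le_of_levyProkhorovEDist_lt hcon hK.measurableSet
  rw [ENNReal.toReal_ofReal hc0.le, empirical_apply x hK.measurableSet,
    empirical_apply y Metric.isOpen_thickening.measurableSet,
    ← ENNReal.ofReal_add (by positivity) hc0.le, ENNReal.ofReal_le_ofReal_iff (by positivity)] at h
  have hcard : (Finset.univ.filter fun i => y i ∈ Metric.thickening c K).card ≤
      (Finset.univ.filter fun i => y i ∈ K).card := by
    refine Finset.card_le_card (Finset.monotone_filter_right _ fun i _ hi => ?_)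
    obtain ⟨z, hz, hd⟩ := Metric.mem_thickening_iff.1 hi
    refine (hy i).resolve_right fun hL => ?_
    have := hKL z hz _ hL
    rw [dist_comm] at this
    exact absurd (this.trans_lt hd) (not_lt.2 (min_le_left _ _))
  have h₁ : ((Finset.univ.filter fun i => y i ∈ Metric.thickening c K).card : ℝ) + 1 ≤
      (Finset.univ.filter fun i => x i ∈ K).card := by exact_mod_cast hcard.trans_lt hlt
  have h₂ : c ≤ 1 / ((m : ℝ) + 1) := min_le_right _ _
  have h₃ : 1 / ((m : ℝ) + 1) < 1 / m := one_div_lt_one_div_of_lt hm (by linarith)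
  have h₄ := div_le_div_of_nonneg_right h₁ hm.le
  rw [add_div] at h₄
  linarith

end Empirical

/-- Points following every prescribed itinerary. -/
theorem exists_itinerary {X : Type*} {g : X → X} {J : Bool → Set X} (hne : ∀ i, (J i).Nonempty)
    (hcov : ∀ i j, J j ⊆ g '' J i) (n : ℕ) (s : ℕ → Bool) :
    ∃ x, ∀ j ≤ n, g^[j] x ∈ J (s j) := by
  induction n generalizing s with
  | zero =>
    obtain ⟨x, hx⟩ := hne (s 0)
    exact ⟨x, fun j hj => by obtain rfl : j = 0 := by omega
                             exact hx⟩
  | succ n ih =>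
    obtain ⟨y, hy⟩ := ih fun j => s (j + 1)
    obtain ⟨x, hx, rfl⟩ := hcov (s 0) _ (hy 0 n.zero_le)
    refine ⟨x, fun j hj => ?_⟩
    cases j with
    | zero => exact hx
    | succ j => exact hy j (by omega)

/-- If an iterate of `f` maps each of two sets at positive distance over both, then the induced
map on measures has infinite entropy. Empirical measures of `m` points realize every sequence in
`{0, …, m}` as the numbers of points lying in the first set, whence at least `(m + 1) ^ n`
separated measures for each `n`. -/
theorem entropy_induced_eq_top {X : Type*} [PseudoMetricSpace X] [MeasurableSpace X] [BorelSpace X]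
    (f : C(X, X)) {N : ℕ} (hN : 1 ≤ N) {J : Bool → Set X} (hJ : ∀ i, IsClosed (J i))
    (hne : ∀ i, (J i).Nonempty) {δ : ℝ} (hδ : 0 < δ)
    (hdist : ∀ x ∈ J true, ∀ y ∈ J false, δ ≤ dist x y) (hcov : ∀ i j, J j ⊆ f^[N] '' J i) :
    entropy (fun _ : ℕ => induced f) = ⊤ := by
  classical
  have key : ∀ m : ℕ, ((Real.log (m + 1 + 1 : ℕ) / N : ℝ) : EReal) ≤
      entropy (fun _ : ℕ => induced f) := by
    intro m'
    set m := m' + 1 with hm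
    have hc0 : 0 < min δ (1 / ((m : ℝ) + 1)) := lt_min hδ (by positivity)
    refine log_div_le_entropy _ hN (by omega) (half_pos hc0) fun n => ?_
    have hpt : ∀ k : Fin n → Fin (m + 1), ∀ i : Fin m, ∃ x, ∀ j : Fin n,
        f^[N * j] x ∈ J (decide (i.val < (k j).val)) := by
      intro k i
      obtain ⟨x, hx⟩ := exists_itinerary hne hcov n
        fun j => if h : j < n then decide (i.val < (k ⟨j, h⟩).val) else false
      refine ⟨x, fun j => ?_⟩
      have := hx j j.2.le
      rwa [dif_pos j.2, ← Function.iterate_mul] at this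
    choose x hx using hpt
    have hmem : ∀ k i (j : Fin n), f^[N * j] (x k i) ∈ J true ↔ i.val < (k j).val := by
      intro k i j
      have := hx k i j
      by_cases hlt : i.val < (k j).val
      · simpa [hlt] using this
      · simp only [hlt, decide_false, iff_false] at this ⊢
        intro hT
        have := hdist _ hT _ this
        rw [dist_self] at this
        linarith
    have hsep : ∀ k k' (j : Fin n), k j < k' j → min δ (1 / ((m : ℝ) + 1)) / 2 <
        dist (iter (fun _ => induced f) (N * j) (empirical (x k')))
          (iter (fun _ => induced f) (N * j) (empirical (x k))) := by
      intro k k' j hlt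
      rw [iter_induced_empirical, iter_induced_empirical]
      refine (half_lt_self hc0).trans_le (le_dist_empirical (hJ true) hδ hdist _ _ ?_ ?_)
      · intro i
        have := hx k i j
        cases hb : decide (i.val < (k j).val) <;> rw [hb] at this
        · exact Or.inr this
        · exact Or.inl this
      · simp only [Function.comp_apply, hmem]
        refine Finset.card_lt_card (Finset.ssubset_iff_of_subset ?_ |>.2 ?_)
        · exact Finset.monotone_filter_right _ fun i _ hi => lt_trans hi hlt
        · exact ⟨⟨k j, lt_of_lt_of_le hlt (Nat.lt_succ_iff.1 (k' j).2)⟩, by simpa using hlt,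
            by simp⟩
    have hsep' : ∀ k k', k ≠ k' → ∃ j : Fin n, min δ (1 / ((m : ℝ) + 1)) / 2 <
        dist (iter (fun _ => induced f) (N * j) (empirical (x k)))
          (iter (fun _ => induced f) (N * j) (empirical (x k'))) := by
      intro k k' hkk
      obtain ⟨j, hj⟩ := Function.ne_iff.1 hkk
      rcases lt_or_gt_of_ne hj with h | h
      · exact ⟨j, by rw [dist_comm]; exact hsep k k' j h⟩
      · exact ⟨j, hsep k' k j h⟩
    have hinj : Function.Injective fun k => empirical (x k) := by
      intro k k' h
      by_contra hkk
      obtain ⟨j, hj⟩ := hsep' k k' hkk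
      simp only at h
      rw [h, dist_self] at hj
      linarith
    refine le_iSup₂_of_le (range fun k => empirical (x k)) ?_ ?_
    · rintro _ ⟨k, rfl⟩ _ ⟨k', rfl⟩ hne'
      obtain ⟨j, hj⟩ := hsep' k k' fun h => hne' (by rw [h])
      exact ⟨N * j, Nat.mul_lt_mul_of_pos_left j.2 hN, hj⟩
    · rw [← image_univ, hinj.encard_image]
      simp [encard_univ]
  have hlim : Tendsto (fun m : ℕ => Real.log (m + 1 + 1 : ℕ) / N) atTop atTop :=
    (Real.tendsto_log_atTop.comp (tendsto_natCast_atTop_atTop.comp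
      ((tendsto_add_atTop_nat 1).comp (tendsto_add_atTop_nat 1)))).atTop_div_const
        (by exact_mod_cast hN)
  rw [EReal.eq_top_iff_forall_lt]
  intro y
  obtain ⟨m, hm⟩ := (hlim.eventually_gt_atTop y).exists
  exact (EReal.coe_lt_coe_iff.2 hm).trans_le (key m)

/-! ### Slowing a system down -/

/-- An unbounded counter with steps `0` and `1` that reaches each positive level `k` only after
time `B k`. -/
theorem exists_slow_counter (B : ℕ → ℕ) : ∃ σ : ℕ → ℕ, σ 0 = 0 ∧
    (∀ n, σ (n + 1) = σ n ∨ σ (n + 1) = σ n + 1) ∧ Tendsto σ atTop atTop ∧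
    ∀ n, σ n = 0 ∨ B (σ n) ≤ n := by
  let σ : ℕ → ℕ := fun n => Nat.rec 0 (fun n k => if B (k + 1) ≤ n + 1 then k + 1 else k) n
  have hσ : ∀ n, σ (n + 1) = if B (σ n + 1) ≤ n + 1 then σ n + 1 else σ n := fun n => rfl
  have hstep : ∀ n, σ (n + 1) = σ n ∨ σ (n + 1) = σ n + 1 := fun n => by
    rw [hσ]; split_ifs <;> simp
  have hmono : Monotone σ := monotone_nat_of_le_succ fun n => by
    rcases hstep n with h | h <;> omega
  refine ⟨σ, rfl, hstep, tendsto_atTop_atTop_of_monotone hmono fun k => ?_, fun n => ?_⟩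
  · induction k with
    | zero => exact ⟨0, Nat.zero_le _⟩
    | succ k ih =>
      obtain ⟨n, hn⟩ := ih
      rcases hn.lt_or_eq with h | h
      · exact ⟨n, h⟩
      by_contra! hcon
      have hk : ∀ m, n ≤ m → σ m = k := fun m hm => by
        have h₁ := hmono hm
        have h₂ := hcon m
        omega
      have h₁ := hk (max n (B (k + 1))) (le_max_left _ _)
      have h₂ := hσ (max n (B (k + 1)))
      rw [h₁, if_pos ((le_max_right _ _).trans (Nat.le_succ _)),
        hk _ ((le_max_left _ _).trans (Nat.le_succ _))] at h₂
      omega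
  · induction n with
    | zero => exact Or.inl rfl
    | succ n ih =>
      rw [hσ]
      split_ifs with h
      · exact Or.inr h
      · exact ih.imp_right fun h => h.trans n.le_succ

theorem iter_slowed {X : Type*} (G : ℕ → X → X) {σ : ℕ → ℕ} (h0 : σ 0 = 0)
    (hσ : ∀ n, σ (n + 1) = σ n ∨ σ (n + 1) = σ n + 1) (n : ℕ) :
    iter (fun n => if σ (n + 1) = σ n then id else G (σ n)) n = iter G (σ n) := by
  induction n with
  | zero => rw [h0]; rfl
  | succ n ih =>
    rw [iter, ih]
    rcases hσ n with h | h
    · simp [h]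
    · rw [h, iter, if_neg (by omega)]

/-- Inserting sufficiently many identity maps makes the entropy of any system on a compact space
vanish: the number of separated sets up to level `k` of the original system is finite, and the
slowed system stays at that level long enough for it to be negligible. -/
theorem exists_slowdown {X : Type*} [PseudoMetricSpace X] [CompactSpace X] [Nonempty X]
    (G : ℕ → X → X) (hG : ∀ n, Continuous (G n)) : ∃ σ : ℕ → ℕ, σ 0 = 0 ∧
      (∀ n, σ (n + 1) = σ n ∨ σ (n + 1) = σ n + 1) ∧ Tendsto σ atTop atTop ∧
      entropy (fun n => if σ (n + 1) = σ n then id else G (σ n)) = 0 := by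
  set C : ℕ → ℕ := fun k => (maxSeparated G (k + 1) (1 / ((k : ℝ) + 1))).toNat with hC
  have hCfin : ∀ k : ℕ, (C k : ℕ∞) = maxSeparated G (k + 1) (1 / ((k : ℝ) + 1)) := fun k =>
    ENat.natCast_toNat (maxSeparated_lt_top G hG _ (by positivity)).ne
  have hC1 : ∀ k, 1 ≤ C k := fun k => by
    have := one_le_maxSeparated G (k + 1) (1 / ((k : ℝ) + 1))
    rw [← hCfin] at this
    exact_mod_cast this
  obtain ⟨σ, h0, hstep, htend, hB⟩ :=
    exists_slow_counter fun k => ⌈((k : ℝ) + 1) * Real.log (C k)⌉₊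
  refine ⟨σ, h0, hstep, htend, le_antisymm (iSup₂_le fun ε hε => ?_) (entropy_nonneg _)⟩
  have hmono : Monotone σ := monotone_nat_of_le_succ fun n => by
    rcases hstep n with h | h <;> omega
  have hlim : Tendsto (fun n => ((1 / ((σ n : ℝ) + 1) : ℝ) : EReal)) atTop (𝓝 0) := by
    have := (tendsto_one_div_add_atTop_nhds_zero_nat (𝕜 := ℝ)).comp htend
    exact (continuous_coe_real_ereal.tendsto 0).comp this
  rw [← hlim.limsup_eq]
  refine limsup_le_limsup ?_
  have hsmall : ∀ᶠ n in atTop, 1 / ((σ n : ℝ) + 1) < ε :=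
    ((tendsto_one_div_add_atTop_nhds_zero_nat (𝕜 := ℝ)).comp htend).eventually_lt_const hε
  filter_upwards [hsmall, htend.eventually_ge_atTop 1, eventually_gt_atTop 0] with n hn hσn hn0
  have hBn : ((σ n : ℝ) + 1) * Real.log (C (σ n)) ≤ n :=
    Nat.ceil_le.1 ((hB n).resolve_left (by omega))
  have hle : maxSeparated (fun n => if σ (n + 1) = σ n then id else G (σ n)) n ε ≤ C (σ n) := by
    rw [hCfin]
    refine (maxSeparated_le_of_iter _ G n (σ n + 1) ε fun j hj => ?_).trans
      (maxSeparated_anti G _ hn.le)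
    exact ⟨σ j, Nat.lt_succ_of_le (hmono hj.le), iter_slowed G h0 hstep j⟩
  have hle' : (maxSeparated (fun n => if σ (n + 1) = σ n then id else G (σ n)) n ε : ENNReal) ≤
      (C (σ n) : ENNReal) := by
    have := ENat.toENNReal_mono hle
    simpa using this
  have hn0' : (0 : ℝ) < n := by exact_mod_cast hn0
  rw [EReal.div_le_iff_le_mul (by exact_mod_cast hn0') (EReal.natCast_ne_top _)]
  refine (ENNReal.log_monotone hle').trans ?_
  rw [log_natCast (hC1 _), ← EReal.coe_coe_eq_natCast, ← EReal.coe_mul, EReal.coe_le_coe_iff]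
  rw [mul_one_div, le_div_iff₀ (by positivity)]
  linarith

/-! ### A transitive flow on the interval -/

section Flow

variable {a b : ℝ}

theorem flow_denom_pos (hab : a < b) (s : ℝ) (x : Icc a b) :
    0 < (b - x) + Real.exp s * (x - a) := by
  have h₁ : 0 ≤ b - x := sub_nonneg.2 x.2.2
  have h₂ : 0 ≤ x - a := sub_nonneg.2 x.2.1
  have h₃ := Real.exp_pos s
  rcases h₂.eq_or_lt with h | h
  · rw [← h]; linarith
  · positivity

/-- The flow of projective maps of `[a, b]` fixing both end points, in which time `s` multiplies
the ratio `(x - a) / (b - x)` by `exp s`. -/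
noncomputable def flow (hab : a < b) (s : ℝ) : C(Icc a b, Icc a b) where
  toFun x := ⟨(a * (b - x) + b * (Real.exp s * (x - a))) / ((b - x) + Real.exp s * (x - a)), by
    have h := flow_denom_pos hab s x
    have h₁ : 0 ≤ b - x := sub_nonneg.2 x.2.2
    have h₂ : 0 ≤ Real.exp s * (x - a) := mul_nonneg (Real.exp_pos s).le (sub_nonneg.2 x.2.1)
    rw [mem_Icc, le_div_iff₀ h, div_le_iff₀ h]
    constructor <;> nlinarith⟩
  continuous_toFun := by
    refine Continuous.subtype_mk (Continuous.div (by fun_prop) (by fun_prop) fun x => ?_) _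
    exact (flow_denom_pos hab s x).ne'

theorem flow_apply (hab : a < b) (s : ℝ) (x : Icc a b) : (flow hab s x : ℝ) =
    (a * (b - x) + b * (Real.exp s * (x - a))) / ((b - x) + Real.exp s * (x - a)) := rfl

theorem flow_zero (hab : a < b) : flow hab 0 = ContinuousMap.id _ := by
  ext x
  have h := flow_denom_pos hab 0 x
  rw [flow_apply, div_eq_iff h.ne', Real.exp_zero]
  simp only [ContinuousMap.id_apply]
  ring

theorem flow_flow (hab : a < b) (s t : ℝ) (x : Icc a b) :
    flow hab s (flow hab t x) = flow hab (s + t) x := by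
  have h₁ := flow_denom_pos hab t x
  have h₂ := flow_denom_pos hab (s + t) x
  have h₃ := flow_denom_pos hab s (flow hab t x)
  apply Subtype.ext
  have hba : b - a ≠ 0 := (sub_pos.2 hab).ne'
  have e₁ : b - (flow hab t x : ℝ) =
      (b - a) * (b - x) / ((b - x) + Real.exp t * (x - a)) := by
    rw [flow_apply, eq_div_iff h₁.ne', sub_mul, div_mul_cancel₀ _ h₁.ne']; ring
  have e₂ : (flow hab t x : ℝ) - a =
      (b - a) * (Real.exp t * (x - a)) / ((b - x) + Real.exp t * (x - a)) := by
    rw [flow_apply, eq_div_iff h₁.ne', sub_mul, div_mul_cancel₀ _ h₁.ne']; ring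
  rw [flow_apply hab s, flow_apply hab (s + t), div_eq_div_iff h₃.ne' h₂.ne', e₁, e₂, Real.exp_add]
  field_simp

theorem abs_flow_sub_le (hab : a < b) (s : ℝ) (x : Icc a b) :
    |(flow hab s x : ℝ) - x| ≤ (b - a) * |Real.exp s - 1| := by
  have h := flow_denom_pos hab s x
  have h₁ : 0 ≤ b - x := sub_nonneg.2 x.2.2
  have h₂ : 0 ≤ x - a := sub_nonneg.2 x.2.1
  have e : (flow hab s x : ℝ) - x =
      (x - a) * (Real.exp s - 1) * ((b - x) / ((b - x) + Real.exp s * (x - a))) := by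
    rw [flow_apply, mul_div_assoc', eq_div_iff h.ne', sub_mul, div_mul_cancel₀ _ h.ne']; ring
  have hq : |(b - x) / ((b - x) + Real.exp s * (x - a))| ≤ 1 := by
    rw [abs_of_nonneg (by positivity), div_le_one h]
    nlinarith [Real.exp_pos s]
  rw [e, abs_mul, abs_mul, abs_of_nonneg h₂]
  calc _ ≤ (x - a) * |Real.exp s - 1| * 1 := by gcongr
    _ ≤ _ := by rw [mul_one]; gcongr; exact x.2.2

theorem exists_flow_eq (hab : a < b) {x y : Icc a b} (hx : (x : ℝ) ∈ Ioo a b)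
    (hy : (y : ℝ) ∈ Ioo a b) : ∃ s, flow hab s x = y := by
  have hxa := sub_pos.2 hx.1
  have hxb := sub_pos.2 hx.2
  have hya := sub_pos.2 hy.1
  have hyb := sub_pos.2 hy.2
  refine ⟨Real.log ((y - a) * (b - x) / ((b - y) * (x - a))), Subtype.ext ?_⟩
  have h := flow_denom_pos hab (Real.log ((y - a) * (b - x) / ((b - y) * (x - a)))) x
  rw [flow_apply, div_eq_iff h.ne', Real.exp_log (by positivity)]
  field_simp
  ring

theorem continuous_flow_time (hab : a < b) (x : Icc a b) : Continuous fun s => flow hab s x := by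
  refine Continuous.subtype_mk (Continuous.div (by fun_prop) (by fun_prop) fun s => ?_) _
  exact (flow_denom_pos hab s x).ne'

end Flow

/-! ### A dense sequence of times with vanishing increments -/

/-- The function `v sin v` of `v = t ^ (1/4)`. It oscillates with unbounded amplitude, and its
increments are at most the sum of those of `v` and of `v ^ 2 = √t`. -/
noncomputable def osc (t : ℝ) : ℝ := √√t * Real.sin √√t

theorem abs_osc_sub_le {n : ℕ} {t : ℝ} (hnt : n ≤ t) (htn : t ≤ n + 1) :
    |osc t - osc n| ≤ 2 / √((n : ℝ) + 1) := by
  set v := √√(n : ℝ) with hv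
  set w := √√t with hw
  set p := √√((n : ℝ) + 1) with hp
  have hv0 : 0 ≤ v := Real.sqrt_nonneg _
  have hvw : v ≤ w := Real.sqrt_le_sqrt (Real.sqrt_le_sqrt hnt)
  have hwp : w ≤ p := Real.sqrt_le_sqrt (Real.sqrt_le_sqrt htn)
  have hv2 : v ^ 2 = √(n : ℝ) := Real.sq_sqrt (Real.sqrt_nonneg _)
  have hp2 : p ^ 2 = √((n : ℝ) + 1) := Real.sq_sqrt (Real.sqrt_nonneg _)
  have hp1 : 1 ≤ p := by
    rw [hp, Real.one_le_sqrt, Real.one_le_sqrt]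
    linarith [(n.cast_nonneg : (0 : ℝ) ≤ n)]
  have h4 : p ^ 2 * p ^ 2 - v ^ 2 * v ^ 2 = 1 := by
    rw [hv2, hp2, Real.mul_self_sqrt (by positivity), Real.mul_self_sqrt (by positivity)]
    ring
  have e : osc t - osc n = (w - v) * Real.sin w + v * (Real.sin w - Real.sin v) := by
    simp only [osc, ← hv, ← hw]; ring
  have h₁ : |(w - v) * Real.sin w| ≤ w - v := by
    rw [abs_mul, abs_of_nonneg (sub_nonneg.2 hvw)]
    exact mul_le_of_le_one_right (sub_nonneg.2 hvw) (Real.abs_sin_le_one w)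
  have h₂ : |v * (Real.sin w - Real.sin v)| ≤ v * (w - v) := by
    rw [abs_mul, abs_of_nonneg hv0]
    gcongr
    have := Real.abs_sin_sub_sin_le w v
    rwa [abs_of_nonneg (sub_nonneg.2 hvw)] at this
  -- As `p ≥ 1`, the increment of the fourth root is at most that of the square root.
  have h₃ : |osc t - osc n| ≤ 2 * (p ^ 2 - v ^ 2) := by
    rw [e]
    refine (abs_add_le _ _).trans ?_
    have : (w - v) * (1 + v) ≤ (p - v) * (2 * (p + v)) := by gcongr <;> linarith
    nlinarith
  refine h₃.trans ?_
  rw [← hp2, le_div_iff₀ (by positivity)]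
  have : v ^ 2 ≤ p ^ 2 := by gcongr; linarith
  nlinarith [sq_nonneg v]

theorem tendsto_two_div_sqrt :
    Tendsto (fun n : ℕ => 2 / √((n : ℝ) + 1)) atTop (𝓝 0) := by
  refine Tendsto.const_div_atTop (Real.tendsto_sqrt_atTop.comp ?_) 2
  exact tendsto_atTop_add_const_right _ 1 tendsto_natCast_atTop_atTop

theorem osc_pow_four {u : ℝ} (hu : 0 ≤ u) : osc (u ^ 4) = u * Real.sin u := by
  rw [osc, show u ^ 4 = (u ^ 2) ^ 2 by ring, Real.sqrt_sq (by positivity), Real.sqrt_sq hu]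

theorem continuous_osc : Continuous osc := by
  unfold osc
  fun_prop

/-- The tails of the sequence `osc n` are dense in the line. -/
theorem exists_osc_near (y : ℝ) {ε : ℝ} (hε : 0 < ε) (K : ℕ) :
    ∃ n : ℕ, K ≤ n ∧ |osc n - y| < ε := by
  obtain ⟨M, hM⟩ := eventually_atTop.1 (tendsto_two_div_sqrt.eventually_lt_const hε)
  -- The value `y` is taken beyond any bound, since `osc` is `±u` at suitable `u ^ 4`.
  obtain ⟨k, hk⟩ := exists_nat_ge (|y| + K + M + 1)
  have hk0 : (1 : ℝ) ≤ k := by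
    linarith [abs_nonneg y, (K.cast_nonneg : (0 : ℝ) ≤ K), (M.cast_nonneg : (0 : ℝ) ≤ M)]
  have hπ := Real.pi_gt_three
  set u₁ := Real.pi / 2 + k * (2 * Real.pi) with hu₁
  set u₂ := -(Real.pi / 2) + k * (2 * Real.pi) with hu₂
  have hku₂ : (k : ℝ) ≤ u₂ := by nlinarith
  have hu₂₁ : u₂ ≤ u₁ := by linarith
  have hs₁ : osc (u₁ ^ 4) = u₁ := by
    rw [osc_pow_four (by linarith), hu₁, Real.sin_add_nat_mul_two_pi, Real.sin_pi_div_two, mul_one]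
  have hs₂ : osc (u₂ ^ 4) = -u₂ := by
    rw [osc_pow_four (by linarith), hu₂, Real.sin_add_nat_mul_two_pi, Real.sin_neg,
      Real.sin_pi_div_two, mul_neg_one]
  have hy := abs_le.1 (le_refl |y|)
  have hK0 : (0 : ℝ) ≤ K := K.cast_nonneg
  have hM0 : (0 : ℝ) ≤ M := M.cast_nonneg
  obtain ⟨t, ht, hty⟩ := intermediate_value_Icc (pow_le_pow_left₀ (by linarith) hu₂₁ 4)
    continuous_osc.continuousOn (show y ∈ Icc (osc (u₂ ^ 4)) (osc (u₁ ^ 4)) by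
      rw [hs₁, hs₂]; constructor <;> linarith)
  have htk : (k : ℝ) ≤ t := hku₂.trans ((le_self_pow₀ (hk0.trans hku₂) (by norm_num)).trans ht.1)
  have hfl : ∀ m : ℕ, (m : ℝ) ≤ k → m ≤ ⌊t⌋₊ := fun m hm => Nat.le_floor (hm.trans htk)
  refine ⟨⌊t⌋₊, hfl K (by linarith [abs_nonneg y]), ?_⟩
  rw [← hty, abs_sub_comm]
  refine (abs_osc_sub_le (Nat.floor_le (by linarith)) (Nat.lt_floor_add_one t).le).trans_lt ?_
  exact hM _ (hfl M (by linarith [abs_nonneg y]))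

theorem tendsto_osc_increment :
    Tendsto (fun n : ℕ => osc ((n + 1 : ℕ) : ℝ) - osc n) atTop (𝓝 0) :=
  squeeze_zero_norm (fun n => by
    rw [Real.norm_eq_abs, Nat.cast_add, Nat.cast_one]
    exact abs_osc_sub_le (by linarith) le_rfl) tendsto_two_div_sqrt

/-! ### The transitive sequence -/

/-- The sequence of flow maps whose compositions are the flow at the times `osc n`. -/
noncomputable def oscMap {a b : ℝ} (hab : a < b) (n : ℕ) : C(Icc a b, Icc a b) :=
  flow hab (osc ((n + 1 : ℕ) : ℝ) - osc n)

theorem iter_oscMap {a b : ℝ} (hab : a < b) (n : ℕ) :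
    iter (fun n => ⇑(oscMap hab n)) n = flow hab (osc n) := by
  induction n with
  | zero =>
    have : osc ((0 : ℕ) : ℝ) = 0 := by simp [osc]
    rw [this, flow_zero]
    rfl
  | succ n ih =>
    funext x
    rw [iter, ih, Function.comp_apply, oscMap, flow_flow, sub_add_cancel]

theorem tendstoUniformly_oscMap {a b : ℝ} (hab : a < b) :
    TendstoUniformly (fun n x => oscMap hab n x) id atTop := by
  rw [Metric.tendstoUniformly_iff]
  intro ε hε
  have hlim : Tendsto (fun n : ℕ => (b - a) * |Real.exp (osc ((n + 1 : ℕ) : ℝ) - osc n) - 1|)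
      atTop (𝓝 0) := by
    have h : Continuous fun s : ℝ => (b - a) * |Real.exp s - 1| := by fun_prop
    have := (h.tendsto 0).comp tendsto_osc_increment
    simpa [Function.comp_def] using this
  filter_upwards [hlim.eventually_lt_const hε] with n hn x
  rw [dist_comm, Subtype.dist_eq, Real.dist_eq]
  exact (abs_flow_sub_le hab _ x).trans_lt hn

theorem exists_mem_interior_of_isOpen {a b : ℝ} (hab : a < b) {U : Set (Icc a b)} (hU : IsOpen U)
    (hne : U.Nonempty) : ∃ x ∈ U, (x : ℝ) ∈ Ioo a b := by
  obtain ⟨W, hW, rfl⟩ := isOpen_induced_iff.1 hU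
  obtain ⟨x, hx⟩ := hne
  have hcl : (x : ℝ) ∈ closure (Ioo a b) := by
    rw [closure_Ioo hab.ne]
    exact x.2
  obtain ⟨y, hyW, hy⟩ := mem_closure_iff.1 hcl W hW hx
  exact ⟨⟨y, Ioo_subset_Icc_self hy⟩, hyW, hy⟩

theorem isTransitive_oscMap {a b : ℝ} (hab : a < b) : IsTransitive (fun n => ⇑(oscMap hab n)) := by
  intro U V hU hV hUne hVne
  obtain ⟨x, hxU, hx⟩ := exists_mem_interior_of_isOpen hab hU hUne
  obtain ⟨y, hyV, hy⟩ := exists_mem_interior_of_isOpen hab hV hVne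
  -- The flow takes `x` to `y` at some time `s`, and into `V` at all times near `s`.
  obtain ⟨s, rfl⟩ := exists_flow_eq hab hx hy
  obtain ⟨ε, hε, hball⟩ :=
    Metric.isOpen_iff.1 (hV.preimage (continuous_flow_time hab x)) s hyV
  obtain ⟨n, hn, hns⟩ := exists_osc_near s hε 1
  refine ⟨n, hn, flow hab (osc n) x, ⟨x, hxU, by rw [iter_oscMap]⟩, hball ?_⟩
  rwa [Metric.mem_ball, Real.dist_eq]

end NonAutonomous

open NonAutonomous in
theorem theorem2p5 (a b : ℝ) (hab : a < b) :
    (∀ f : C(Icc a b, Icc a b), NonAutonomous.IsTransitive (fun _ : ℕ => ⇑f) →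
      NonAutonomous.entropy (fun _ : ℕ => NonAutonomous.induced f) = ⊤) ∧
    (∃ f : ℕ → C(Icc a b, Icc a b),
      TendstoUniformly (fun n x => f n x) id atTop ∧
      NonAutonomous.IsTransitive (fun n => ⇑(f n)) ∧
      NonAutonomous.entropy (fun n => NonAutonomous.induced (f n)) = 0) := by
  refine ⟨fun f hf => ?_, ?_⟩
  · obtain ⟨N, hN, J, hJ, hne, ⟨δ, hδ, hdist⟩, hcov⟩ := hf.exists_horseshoe hab f
    exact entropy_induced_eq_top f hN hJ hne hδ hdist hcov
  have : Nonempty (ProbSpace (Icc a b)) :=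
    ⟨LevyProkhorov.ofMeasure ⟨Measure.dirac ⟨a, left_mem_Icc.2 hab.le⟩, inferInstance⟩⟩
  obtain ⟨σ, h0, hstep, htend, hent⟩ :=
    exists_slowdown (fun n => induced (oscMap hab n)) fun n => continuous_induced _
  refine ⟨fun n => if σ (n + 1) = σ n then ContinuousMap.id _ else oscMap hab (σ n), ?_, ?_, ?_⟩
  · rw [Metric.tendstoUniformly_iff]
    intro ε hε
    filter_upwards [htend.eventually
      (Metric.tendstoUniformly_iff.1 (tendstoUniformly_oscMap hab) ε hε)] with n hn x
    split_ifs
    · simpa using hε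
    · exact hn x
  · -- As `σ` takes all values, the slowed system visits all compositions of the original one.
    intro U V hU hV hUne hVne
    obtain ⟨k, hk, h⟩ := isTransitive_oscMap hab U V hU hV hUne hVne
    obtain ⟨n, rfl⟩ : ∃ n, σ n = k := by
      classical
      have hex : ∃ n, k ≤ σ n := (htend.eventually_ge_atTop k).exists
      have h₁ := Nat.find_spec hex
      obtain ⟨m, hm⟩ : ∃ m, Nat.find hex = m + 1 := Nat.exists_eq_succ_of_ne_zero fun h => by
        rw [h, h0] at h₁; omega
      have h₂ := Nat.find_min hex (m := m) (by omega)
      rw [hm] at h₁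
      exact ⟨m + 1, by rcases hstep m with h | h <;> omega⟩
    refine ⟨n, Nat.one_le_iff_ne_zero.2 fun hn => by rw [hn, h0] at hk; omega, ?_⟩
    have hfun : (fun n => ⇑(if σ (n + 1) = σ n then ContinuousMap.id (Icc a b) else
        oscMap hab (σ n))) = fun n => if σ (n + 1) = σ n then id else ⇑(oscMap hab (σ n)) := by
      funext n
      split_ifs <;> rfl
    rwa [hfun, iter_slowed (fun n => ⇑(oscMap hab n)) h0 hstep]
  · rw [← hent]
    congr 1
    funext n
    dsimp only
    split_ifs
    · exact NonAutonomous.induced_id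
    · rfl
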